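/- Let $K \subset \mathbb{R}^2$ be an analytic set with Hausdorff dimension $0 \le \dim K \le 1$. For $e \in S^1 = \{x \in \mathbb{R}^2 : |x| = 1\}$ let $K_e = \{x \cdot e : x \in K\} \subset \mathbb{R}$. For a bounded set $B \subset \mathbb{R}$ and $\delta > 0$ let $N(B,\delta)$ be the least number $j \ge 1$ of balls of radius $\delta$ that cover $B$, put $$\overline{\dim}_{\mathrm{B}} B = \limsup_{\delta \to 0} \frac{\log N(B,\delta)}{-\log \delta},$$ and for arbitrary $B \subset \mathbb{R}$ define the packing dimension by $$\dim_{\mathrm{p}} B = \inf\Big\{ \sup_j \overline{\dim}_{\mathrm{B}} F_j : B \subset \bigcup_{j \in \mathbb{N}} F_j,\ F_j \subset \mathbb{R} \text{ bounded}\Big\}.$$ Then the set $$\{e \in S^1 : \dim_{\mathrm{p}} K_e < \dim K\}$$ is meagre in $S^1$. -/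

import Mathlib

open Filter Topology Set
open scoped NNReal ENNReal

noncomputable section

/-- `N(B, δ)`: the least number `j ≥ 1` of closed balls of radius `δ` (centred anywhere in `X`)
that cover `B`; it is `⊤` if there is no finite cover. The `max` with `1` only matters for
`B = ∅`. -/
def coverNumber {X : Type*} [PseudoMetricSpace X] (B : Set X) (δ : ℝ≥0) : ℕ∞ :=
  max 1 (Metric.externalCoveringNumber δ B)

/-- The upper box-counting dimension `limsup_{δ → 0+} log N(B, δ) / (-log δ)`. The quotient is
nonnegative for `0 < δ < 1`, so passing to `ℝ≥0∞` changes nothing. -/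
def upperBoxDim {X : Type*} [PseudoMetricSpace X] (B : Set X) : ℝ≥0∞ :=
  limsup (fun δ : ℝ≥0 =>
    (ENNReal.log (coverNumber B δ : ℝ≥0∞) / ((-Real.log δ : ℝ) : EReal)).toENNReal) (𝓝[>] 0)

/-- The packing dimension: the infimum of `sup_j upperBoxDim (F j)` over all countable covers of
`B` by bounded sets `F j`. -/
def packingDim {X : Type*} [PseudoMetricSpace X] (B : Set X) : ℝ≥0∞ :=
  ⨅ (F : ℕ → Set X) (_ : ∀ j, Bornology.IsBounded (F j)) (_ : B ⊆ ⋃ j, F j),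
    ⨆ j, upperBoxDim (F j)

/-- The unit circle in the Euclidean plane, with the subspace topology. -/
abbrev UnitCircle : Type := Metric.sphere (0 : EuclideanSpace ℝ (Fin 2)) 1

/-- The projection `K_e = {x · e : x ∈ K} ⊆ ℝ`. -/
def proj (e : UnitCircle) (K : Set (EuclideanSpace ℝ (Fin 2))) : Set ℝ :=
  (fun x => inner ℝ x (e : EuclideanSpace ℝ (Fin 2))) '' K

end

open MeasureTheory Measure Metric

/-! Fix `s < t < dimH K`, so that `t ≤ 1`. Write `K` as a continuous image of Baire space and
discard every basic open set whose image has dimension at most `t`. What remains is a Polish space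
`P`, each of whose nonempty open portions has image of dimension above `t`. If bounded sets `F j`
cover a projection of `K`, the preimages of their closures cover `P`, so by Baire one of them
contains an open portion. As upper box dimension ignores closures, it suffices to bound it below for
the projections of countably many portions.

For one portion, upper box dimension is a limsup, so it is enough that at arbitrarily fine scales
the good directions contain a dense open set. Density is a discrete Marstrand argument: Frostman
weights at scale `2⁻ⁿ` have few pairs with close projections on average over any arc, and
Cauchy–Schwarz then forces many covering intervals. The estimate survives turning the direction by
`2⁻ⁿ`, which gives openness. -/

/-! ### Discrete Frostman weights -/

/-- Greedy choice of weights: every point lies in a set whose mass attains its bound. -/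
theorem exists_saturated_weights {X ι : Type*} [DecidableEq X] (I : Finset ι)
    (B : ι → Finset X) (b : ι → ℝ) (hb : ∀ i ∈ I, 0 ≤ b i) (S : Finset X)
    (hS : ∀ x ∈ S, ∃ i ∈ I, x ∈ B i) :
    ∃ w : X → ℝ, (∀ x, 0 ≤ w x) ∧ (∀ i ∈ I, ∑ y ∈ B i, w y ≤ b i) ∧
      ∀ x ∈ S, ∃ i ∈ I, x ∈ B i ∧ ∑ y ∈ B i, w y = b i := by
  induction S using Finset.induction_on with
  | empty => exact ⟨0, by simp, by simpa using hb, by simp⟩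
  | insert x S _ ih =>
    obtain ⟨w, hw0, hwb, hws⟩ := ih fun y hy => hS y (Finset.mem_insert_of_mem hy)
    -- Raising the weight of `x` by the least slack among the sets containing it breaks no bound and
    -- makes one tight.
    obtain ⟨i₀, hi₀, hmin⟩ := Finset.exists_min_image (I.filter (x ∈ B ·))
      (fun i => b i - ∑ y ∈ B i, w y) (by
        obtain ⟨i, hi, hxi⟩ := hS x (Finset.mem_insert_self _ _)
        exact ⟨i, by simp [hi, hxi]⟩)
    rw [Finset.mem_filter] at hi₀
    set m := b i₀ - ∑ y ∈ B i₀, w y with hm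
    have hm0 : 0 ≤ m := sub_nonneg.2 (hwb _ hi₀.1)
    set w' : X → ℝ := fun y => w y + if y = x then m else 0
    have hsum : ∀ i, ∑ y ∈ B i, w' y = ∑ y ∈ B i, w y + if x ∈ B i then m else 0 := by
      intro i
      simp [w', Finset.sum_add_distrib]
    refine ⟨w', fun y => ?_, fun i hi => ?_, fun y hy => ?_⟩
    · have := hw0 y
      simp only [w']
      split_ifs <;> linarith
    · rw [hsum]
      split_ifs with h
      · have := hmin i (by simp [hi, h])
        linarith
      · simpa using hwb i hi
    · rcases Finset.mem_insert.1 hy with rfl | hy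
      · exact ⟨i₀, hi₀.1, hi₀.2, by rw [hsum, if_pos hi₀.2]; linarith⟩
      · obtain ⟨i, hi, hyi, hs⟩ := hws y hy
        refine ⟨i, hi, hyi, ?_⟩
        rw [hsum, hs]
        split_ifs with h
        · have := hmin i (by simp [hi, h])
          linarith
        · simp


/-- A set of positive Hausdorff measure has positive Hausdorff content. -/
theorem exists_pos_le_sum_rpow {X : Type*} [MetricSpace X] [MeasurableSpace X] [BorelSpace X]
    (ι : Type*) {A : Set X} {t : ℝ} (ht : 0 < t) (hA : μH[t] A ≠ 0) :
    ∃ c > 0, ∀ (I : Finset ι) (x : ι → X) (r : ι → ℝ), (∀ i ∈ I, 0 ≤ r i) →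
      A ⊆ ⋃ i ∈ I, closedBall (x i) (r i) → c ≤ ∑ i ∈ I, r i ^ t := by
  by_contra! H
  have hpos : ∀ m : ℕ, (0 : ℝ) < 1 / ((m : ℝ) + 1) := fun m => by positivity
  choose I x r hr hcov hlt using fun m : ℕ => H (1 / ((m : ℝ) + 1)) (hpos m)
  apply hA
  -- A small sum of `r ^ t` makes every single radius small, so these covers are fine enough to
  -- compute `μH[t] A`.
  have hlim : Tendsto (fun m : ℕ => 1 / ((m : ℝ) + 1)) atTop (𝓝 0) :=
    tendsto_one_div_add_atTop_nhds_zero_nat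
  have hlim1 : Tendsto (fun m : ℕ => ENNReal.ofReal (2 * (1 / ((m : ℝ) + 1)) ^ (1 / t)))
      atTop (𝓝 0) := by
    have := (hlim.rpow_const (p := 1 / t) (Or.inr (by positivity))).const_mul 2
    rw [Real.zero_rpow (by positivity), mul_zero] at this
    simpa using ENNReal.tendsto_ofReal this
  have hlim2 : Tendsto (fun m : ℕ => ENNReal.ofReal (2 ^ t * (1 / ((m : ℝ) + 1))))
      atTop (𝓝 0) := by
    simpa using ENNReal.tendsto_ofReal (hlim.const_mul (2 ^ t))
  have hdiam : ∀ m (i : I m), ediam (closedBall (x m i) (r m i)) ≤ ENNReal.ofReal (2 * r m i) := by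
    intro m i
    rw [← closedEBall_ofReal (hr m i i.2)]
    exact ediam_closedEBall_le.trans_eq (by rw [ENNReal.ofReal_mul (by norm_num)]; simp)
  refine le_antisymm ?_ zero_le
  refine (hausdorffMeasure_le_liminf_sum (β := ℕ) (ι := fun m => I m) t A (l := atTop) _ hlim1
    (fun m i => closedBall (x m i) (r m i)) ?_ ?_).trans ?_
  · refine Eventually.of_forall fun m i => (hdiam m i).trans (ENNReal.ofReal_le_ofReal ?_)
    have h1 : r m i ^ t ≤ 1 / ((m : ℝ) + 1) :=
      (Finset.single_le_sum (f := fun i => r m i ^ t)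
        (fun j hj => Real.rpow_nonneg (hr m j hj) t) i.2).trans (hlt m).le
    have h2 := Real.rpow_le_rpow (Real.rpow_nonneg (hr m i i.2) t) h1
      (by positivity : 0 ≤ 1 / t)
    rw [← Real.rpow_mul (hr m i i.2), mul_one_div_cancel ht.ne', Real.rpow_one] at h2
    linarith
  · refine Eventually.of_forall fun m => (hcov m).trans ?_
    intro z hz
    simp only [mem_iUnion] at hz ⊢
    obtain ⟨i, hi, hz⟩ := hz
    exact ⟨⟨i, hi⟩, hz⟩
  · rw [← hlim2.liminf_eq]
    refine liminf_le_liminf (Eventually.of_forall fun m => ?_)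
    calc ∑ i : I m, ediam (closedBall (x m i) (r m i)) ^ t
        ≤ ∑ i : I m, ENNReal.ofReal ((2 * r m i) ^ t) := by
          refine Finset.sum_le_sum fun i _ => ?_
          rw [← ENNReal.ofReal_rpow_of_nonneg (by have := hr m i i.2; positivity) ht.le]
          exact ENNReal.rpow_le_rpow (hdiam m i) ht.le
      _ = ENNReal.ofReal (∑ i : I m, (2 * r m i) ^ t) := by
          rw [ENNReal.ofReal_sum_of_nonneg]
          intro i _
          have := hr m i i.2
          positivity
      _ ≤ _ := by
          refine ENNReal.ofReal_le_ofReal ?_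
          rw [Finset.sum_coe_sort (I m) (fun i => (2 * r m i) ^ t)]
          calc ∑ i ∈ I m, (2 * r m i) ^ t = 2 ^ t * ∑ i ∈ I m, r m i ^ t := by
                rw [Finset.mul_sum]
                exact Finset.sum_congr rfl fun i hi => Real.mul_rpow (by norm_num) (hr m i hi)
            _ ≤ _ := by gcongr; exact (hlt m).le

/-- A finite-scale Frostman lemma. -/
theorem exists_frostman_weights {X : Type*} [MetricSpace X] [MeasurableSpace X] [BorelSpace X]
    {A : Set X} (hAb : TotallyBounded A) {t : ℝ} (ht : 0 < t) (hA : μH[t] A ≠ 0) :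
    ∃ c > 0, ∀ n : ℕ, ∃ (S : Finset X) (w : X → ℝ), (S : Set X) ⊆ A ∧ (∀ x, 0 ≤ w x) ∧
      c ≤ ∑ x ∈ S, w x ∧
      ∀ x ∈ S, ∀ k ≤ n, ∑ y ∈ S with dist y x ≤ (1 / 2) ^ k, w y ≤ ((1 / 2 : ℝ) ^ k) ^ t := by
  classical
  obtain ⟨c, hc, hcov⟩ := exists_pos_le_sum_rpow (X × ℕ) ht hA
  refine ⟨c / 5 ^ t, by positivity, fun n => ?_⟩
  obtain ⟨S, hSA, hSf, hAS⟩ := finite_approx_of_totallyBounded hAb ((1 / 2) ^ n) (by positivity)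
  lift S to Finset X using hSf
  obtain ⟨w, hw0, hwb, hws⟩ := exists_saturated_weights (S ×ˢ Finset.range (n + 1))
    (fun p => S.filter fun y => dist y p.1 ≤ (1 / 2) ^ p.2) (fun p => ((1 / 2 : ℝ) ^ p.2) ^ t)
    (fun p _ => by positivity) S (fun x hx => ⟨(x, 0), by simp [hx], by simp [hx]⟩)
  refine ⟨S, w, hSA, hw0, ?_, fun x hx k hk => hwb (x, k) (by simp [hx]; omega)⟩
  set T := (S ×ˢ Finset.range (n + 1)).filter fun p =>
    ∑ y ∈ S with dist y p.1 ≤ (1 / 2) ^ p.2, w y = ((1 / 2 : ℝ) ^ p.2) ^ t with hT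
  obtain ⟨u, huT, hdisj, hu⟩ := Vitali.exists_disjoint_subfamily_covering_enlargement_closedBall
    (T : Set (X × ℕ)) (fun p => p.1) (fun p => (1 / 2 : ℝ) ^ p.2) 1
    (fun p _ => pow_le_one₀ (by norm_num) (by norm_num)) 4 (by norm_num)
  lift u to Finset (X × ℕ) using T.finite_toSet.subset huT
  have hsat : ∀ p ∈ u, p.2 ≤ n ∧
      ∑ y ∈ S with dist y p.1 ≤ (1 / 2) ^ p.2, w y = ((1 / 2 : ℝ) ^ p.2) ^ t := by
    intro p hp
    have := huT hp
    simp only [hT, Finset.coe_filter, mem_ofPred_eq, Finset.mem_product, Finset.mem_range] at this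
    exact ⟨by omega, this.2⟩
  -- The factor 5 is 4 from the Vitali enlargement plus 1 from the net radius `2⁻ⁿ`, which is at
  -- most the radius of each ball.
  have h1 := hcov u (fun p => p.1) (fun p => 5 * (1 / 2) ^ p.2) (fun _ _ => by positivity) (by
    intro z hz
    obtain ⟨x, hx, hzx⟩ := mem_iUnion₂.1 (hAS hz)
    obtain ⟨p, hp, hxp, hs⟩ := hws x hx
    obtain ⟨q, hq, hpq⟩ := hu p (by
      simp only [hT, Finset.coe_filter, mem_ofPred_eq]
      exact ⟨hp, hs⟩)
    refine mem_iUnion₂.2 ⟨q, hq, ?_⟩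
    have h2 : x ∈ closedBall q.1 (4 * (1 / 2) ^ q.2) :=
      hpq (by simpa using (Finset.mem_filter.1 hxp).2)
    have h3 : (1 / 2 : ℝ) ^ n ≤ (1 / 2) ^ q.2 :=
      pow_le_pow_of_le_one (by norm_num) (by norm_num) (hsat q hq).1
    rw [mem_closedBall] at h2 ⊢
    have := dist_triangle z x q.1
    have := mem_ball.1 hzx
    linarith)
  rw [div_le_iff₀ (by positivity)]
  calc c ≤ ∑ p ∈ u, (5 * (1 / 2 : ℝ) ^ p.2) ^ t := h1
    _ = (∑ p ∈ u, ∑ y ∈ S with dist y p.1 ≤ (1 / 2) ^ p.2, w y) * 5 ^ t := by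
      rw [Finset.sum_mul]
      refine Finset.sum_congr rfl fun p hp => ?_
      rw [(hsat p hp).2, Real.mul_rpow (by norm_num) (by positivity), mul_comm]
    _ ≤ _ := by
      gcongr
      rw [← Finset.sum_biUnion]
      · refine Finset.sum_le_sum_of_subset_of_nonneg ?_ fun x _ _ => hw0 x
        intro y hy
        simp only [Finset.mem_biUnion, Finset.mem_filter] at hy
        obtain ⟨_, _, h, _⟩ := hy
        exact h
      · intro p hp q hq hpq
        rw [Function.onFun, Finset.disjoint_left]
        intro y hyp hyq
        exact (hdisj hp hq hpq).le_bot
          ⟨mem_closedBall.2 (Finset.mem_filter.1 hyp).2, mem_closedBall.2 (Finset.mem_filter.1 hyq).2⟩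

/-! ### Transversality and averaging over directions -/

/-- Either the slope satisfies `|b| ≥ L / 2`, or `|a| ≥ L / 2` dominates `s * b`; in the latter case
the set is empty unless `ε` is comparable to `L`, and the trivial bound `2 * h` suffices. -/
theorem volume_real_abs_add_mul_le {a b h ε L : ℝ} (hL : 0 < L) (hab : L ^ 2 = a ^ 2 + b ^ 2)
    (hh : h ≤ 1 / 4) (hε : 0 ≤ ε) :
    volume.real ({s | |a + s * b| ≤ ε} ∩ Icc (-h) h) ≤ 4 * ε / L := by
  by_cases hb : L / 2 ≤ |b|
  · have hb0 : 0 < |b| := by linarith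
    have hsub : {s | |a + s * b| ≤ ε} ∩ Icc (-h) h ⊆ closedBall (-(a / b)) (ε / |b|) := by
      rintro s ⟨hs, -⟩
      rw [mem_closedBall, Real.dist_eq, le_div_iff₀ hb0, ← abs_mul]
      have : (s - -(a / b)) * b = a + s * b := by
        have : b ≠ 0 := abs_pos.1 hb0
        field_simp
        ring
      rwa [this]
    refine (measureReal_mono hsub measure_closedBall_lt_top.ne).trans ?_
    rw [measureReal_def, Real.volume_closedBall, ENNReal.toReal_ofReal (by positivity),
      mul_div_assoc', div_le_div_iff₀ hb0 hL]
    nlinarith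
  · push Not at hb
    rcases ({s | |a + s * b| ≤ ε} ∩ Icc (-h) h).eq_empty_or_nonempty with h0 | ⟨s, hs, hs'⟩
    · rw [h0]; simp; positivity
    · have hsh : |s| ≤ h := abs_le.2 hs'
      have hh0 : 0 ≤ h := (abs_nonneg s).trans hsh
      have ha : L / 2 ≤ |a| := by
        refine abs_le_of_sq_le_sq' ?_ (abs_nonneg a) |>.2
        have : |b| ^ 2 ≤ (L / 2) ^ 2 := by gcongr
        rw [sq_abs] at this ⊢
        nlinarith
      have h1 : |a| ≤ ε + |s| * |b| := by
        have := abs_sub_abs_le_abs_sub a (-(s * b))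
        rw [sub_neg_eq_add, abs_neg, abs_mul] at this
        have : |a + s * b| ≤ ε := hs
        linarith
      have h2 : |s| * |b| ≤ 1 / 4 * (L / 2) := by gcongr; linarith
      refine (measureReal_mono inter_subset_right (by simp)).trans ?_
      rw [measureReal_def, Real.volume_Icc, ENNReal.toReal_ofReal (by linarith), le_div_iff₀ hL]
      nlinarith

/-- The term at the largest `k ≤ n` with `L ≤ 2⁻ᵏ` already suffices, with `48 = 4 * 6 * 2`. Written
as a sum over scales, the bound turns into masses of balls once weighted. -/
theorem volume_real_abs_add_mul_le_sum {a b h L : ℝ} (hL1 : L ≤ 1)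
    (hab : L ^ 2 = a ^ 2 + b ^ 2) (hh0 : 0 ≤ h) (hh : h ≤ 1 / 4) (n : ℕ) :
    volume.real ({s | |a + s * b| ≤ 6 * (1 / 2) ^ n} ∩ Icc (-h) h) ≤
      ∑ k ∈ Finset.range (n + 1), if L ≤ (1 / 2) ^ k then 48 * (1 / 2 : ℝ) ^ (n - k) else 0 := by
  classical
  have hterm : ∀ k ≤ n, L ≤ (1 / 2) ^ k → 48 * (1 / 2 : ℝ) ^ (n - k) ≤
      ∑ k ∈ Finset.range (n + 1), if L ≤ (1 / 2) ^ k then 48 * (1 / 2 : ℝ) ^ (n - k) else 0 := by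
    intro k hk hLk
    refine le_trans (by rw [if_pos hLk]) (Finset.single_le_sum
      (f := fun k => if L ≤ (1 / 2) ^ k then 48 * (1 / 2 : ℝ) ^ (n - k) else 0)
      (fun j _ => ?_) (Finset.mem_range.2 (Nat.lt_succ_of_le hk)))
    split_ifs <;> positivity
  by_cases hn : L ≤ (1 / 2) ^ n
  · refine le_trans ?_ (hterm n le_rfl hn)
    refine (measureReal_mono inter_subset_right (by simp)).trans ?_
    rw [measureReal_def, Real.volume_Icc, ENNReal.toReal_ofReal (by linarith)]
    simp
    linarith
  · set k := Nat.findGreatest (fun k => L ≤ (1 / 2 : ℝ) ^ k) n with hk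
    have hkn : k ≤ n := Nat.findGreatest_le n
    have hLk : L ≤ (1 / 2) ^ k :=
      Nat.findGreatest_spec (P := fun k => L ≤ (1 / 2 : ℝ) ^ k) (Nat.zero_le n) (by simpa using hL1)
    have hkn' : k < n := lt_of_le_of_ne hkn fun h => hn (h ▸ hLk)
    have hLk' : (1 / 2) ^ (k + 1) < L :=
      not_le.1 (Nat.findGreatest_is_greatest (P := fun k => L ≤ (1 / 2 : ℝ) ^ k)
        (Nat.lt_succ_self k) hkn')
    have hL0 : 0 < L := lt_trans (by positivity) hLk'
    refine le_trans ?_ (hterm k hkn hLk)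
    refine (volume_real_abs_add_mul_le hL0 hab hh (by positivity)).trans ?_
    rw [div_le_iff₀ hL0]
    calc 4 * (6 * (1 / 2 : ℝ) ^ n) = 48 * (1 / 2) ^ (n - k) * (1 / 2) ^ (k + 1) := by
          rw [← Nat.sub_add_cancel hkn, pow_add, pow_succ]
          simp only [Nat.add_sub_cancel]
          ring
      _ ≤ _ := by gcongr

/-- Cauchy–Schwarz: a cover by few intervals forces many close pairs. -/
theorem sq_sum_le_card_mul_sum_close {X : Type*} (S : Finset X) {w : X → ℝ} (hw : ∀ x, 0 ≤ w x)
    (T : Finset ℝ) (g : X → ℝ) {δ : ℝ} (hT : ∀ x ∈ S, ∃ τ ∈ T, |g x - τ| ≤ δ)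
    (P : X → X → Prop) [∀ x y, Decidable (P x y)]
    (hP : ∀ x ∈ S, ∀ y ∈ S, |g y - g x| ≤ 2 * δ → P x y) :
    (∑ x ∈ S, w x) ^ 2 ≤ T.card * ∑ x ∈ S, ∑ y ∈ S, if P x y then w x * w y else 0 := by
  classical
  have : ∃ τ : X → ℝ, ∀ x ∈ S, τ x ∈ T ∧ |g x - τ x| ≤ δ := by
    choose! τ hτ using hT
    exact ⟨τ, hτ⟩
  obtain ⟨τ, hτ⟩ := this
  have hmaps : ∀ x ∈ S, τ x ∈ T := fun x hx => (hτ x hx).1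
  rw [← Finset.sum_fiberwise_of_maps_to hmaps]
  refine sq_sum_le_card_mul_sum_sq.trans ?_
  gcongr
  calc ∑ a ∈ T, (∑ x ∈ S with τ x = a, w x) ^ 2
      = ∑ a ∈ T, ∑ x ∈ S with τ x = a, w x * ∑ y ∈ S with τ y = τ x, w y := by
        refine Finset.sum_congr rfl fun a _ => ?_
        rw [sq, Finset.sum_mul]
        refine Finset.sum_congr rfl fun x hx => ?_
        rw [(Finset.mem_filter.1 hx).2]
    _ = ∑ x ∈ S, w x * ∑ y ∈ S with τ y = τ x, w y := Finset.sum_fiberwise_of_maps_to hmaps _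
    _ ≤ _ := by
        refine Finset.sum_le_sum fun x hx => ?_
        rw [Finset.mul_sum, Finset.sum_filter]
        refine Finset.sum_le_sum fun y hy => ?_
        by_cases h : τ y = τ x
        · rw [if_pos h, if_pos]
          refine hP x hx y hy ?_
          have h1 := (hτ x hx).2
          have h2 := (hτ y hy).2
          rw [h] at h2
          rw [abs_le] at *
          constructor <;> linarith
        · rw [if_neg h]
          split_ifs
          · exact mul_nonneg (hw x) (hw y)
          · exact le_rfl

/-- Averaging over directions: some direction in a given arc has few pairs of points with
nearby projections. -/
theorem exists_direction_sum_close_le {E : Type*} [NormedAddCommGroup E] [InnerProductSpace ℝ E]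
    {e f : E} (hef : ∀ z : E, ‖z‖ ^ 2 = inner ℝ z e ^ 2 + inner ℝ z f ^ 2)
    {S : Finset E} (hS : ∀ x ∈ S, ∀ y ∈ S, dist y x ≤ 1) {w : E → ℝ} (hw : ∀ x, 0 ≤ w x)
    {t : ℝ} (ht : t ≤ 1) {n : ℕ}
    (hwt : ∀ x ∈ S, ∀ k ≤ n, ∑ y ∈ S with dist y x ≤ (1 / 2) ^ k, w y ≤ ((1 / 2 : ℝ) ^ k) ^ t)
    {h : ℝ} (hh0 : 0 < h) (hh : h ≤ 1 / 4) :
    ∃ s ∈ Icc (-h) h, ∑ x ∈ S, ∑ y ∈ S,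
      (if |inner ℝ (y - x) e + s * inner ℝ (y - x) f| ≤ 6 * (1 / 2) ^ n then w x * w y else 0) ≤
      24 / h * (n + 1) * ((1 / 2 : ℝ) ^ n) ^ t * ∑ x ∈ S, w x := by
  classical
  set B : E → E → Set ℝ := fun x y =>
    {s | |inner ℝ (y - x) e + s * inner ℝ (y - x) f| ≤ 6 * (1 / 2) ^ n}
  have hB : ∀ x y, MeasurableSet (B x y) := fun x y =>
    (isClosed_le (by fun_prop) continuous_const).measurableSet
  set μ : Measure ℝ := volume.restrict (Icc (-h) h)
  have hint : ∀ x y, Integrable ((B x y).indicator fun _ => w x * w y) μ := fun x y =>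
    (integrable_const _).indicator (hB x y)
  -- Here `t ≤ 1` enters: each of the `n + 1` scales contributes at most `48 * 2⁻ⁿᵗ`.
  have hpow : ∀ k ≤ n, 48 * (1 / 2 : ℝ) ^ (n - k) * ((1 / 2 : ℝ) ^ k) ^ t ≤
      48 * ((1 / 2 : ℝ) ^ n) ^ t := by
    intro k hk
    rw [mul_assoc]
    gcongr
    calc (1 / 2 : ℝ) ^ (n - k) * ((1 / 2 : ℝ) ^ k) ^ t
        ≤ ((1 / 2 : ℝ) ^ (n - k)) ^ t * ((1 / 2 : ℝ) ^ k) ^ t := by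
          gcongr
          conv_lhs => rw [← Real.rpow_one ((1 / 2 : ℝ) ^ (n - k))]
          exact Real.rpow_le_rpow_of_exponent_ge (by positivity)
            (pow_le_one₀ (by norm_num) (by norm_num)) ht
      _ = _ := by
          rw [← Real.mul_rpow (by positivity) (by positivity), ← pow_add, Nat.sub_add_cancel hk]
  have hrow : ∀ x ∈ S, ∑ y ∈ S, w y * μ.real (B x y) ≤ 48 * (n + 1) * ((1 / 2 : ℝ) ^ n) ^ t := by
    intro x hx
    calc ∑ y ∈ S, w y * μ.real (B x y)
        ≤ ∑ y ∈ S, w y * ∑ k ∈ Finset.range (n + 1),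
            (if dist y x ≤ (1 / 2) ^ k then 48 * (1 / 2 : ℝ) ^ (n - k) else 0) := by
          refine Finset.sum_le_sum fun y hy => mul_le_mul_of_nonneg_left ?_ (hw y)
          rw [measureReal_restrict_apply (hB x y)]
          exact volume_real_abs_add_mul_le_sum (hS x hx y hy)
            (by rw [dist_eq_norm]; exact hef _) hh0.le hh n
      _ = ∑ k ∈ Finset.range (n + 1), 48 * (1 / 2 : ℝ) ^ (n - k) *
            ∑ y ∈ S with dist y x ≤ (1 / 2) ^ k, w y := by
          simp_rw [Finset.mul_sum, Finset.sum_filter]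
          rw [Finset.sum_comm]
          refine Finset.sum_congr rfl fun k _ => Finset.sum_congr rfl fun y _ => ?_
          split_ifs <;> ring
      _ ≤ ∑ k ∈ Finset.range (n + 1), 48 * ((1 / 2 : ℝ) ^ n) ^ t := by
          refine Finset.sum_le_sum fun k hk => ?_
          have hk' : k ≤ n := Nat.lt_succ_iff.1 (Finset.mem_range.1 hk)
          refine le_trans ?_ (hpow k hk')
          gcongr
          exact hwt x hx k hk'
      _ = _ := by simp; ring
  obtain ⟨s, hs, hle⟩ := exists_le_setAverage (μ := volume) (s := Icc (-h) h)
    (f := fun s => ∑ x ∈ S, ∑ y ∈ S, (B x y).indicator (fun _ => w x * w y) s)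
    (by rw [Real.volume_Icc]; simp; linarith) (by simp)
    (integrable_finsetSum _ fun x _ => integrable_finsetSum _ fun y _ => hint x y)
  refine ⟨s, hs, ?_⟩
  have heq : ∑ x ∈ S, ∑ y ∈ S,
      (if |inner ℝ (y - x) e + s * inner ℝ (y - x) f| ≤ 6 * (1 / 2) ^ n then w x * w y else 0) =
      ∑ x ∈ S, ∑ y ∈ S, (B x y).indicator (fun _ => w x * w y) s := by
    refine Finset.sum_congr rfl fun x _ => Finset.sum_congr rfl fun y _ => ?_
    simp only [indicator_apply, B, mem_ofPred_eq]
  rw [heq]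
  refine hle.trans ?_
  rw [setAverage_eq, integral_finsetSum _ fun x _ => integrable_finsetSum _ fun y _ => hint x y]
  have hvol : volume.real (Icc (-h) h) = 2 * h := by
    rw [measureReal_def, Real.volume_Icc, ENNReal.toReal_ofReal (by linarith)]
    ring
  rw [hvol, smul_eq_mul]
  have hmain : ∑ x ∈ S, ∫ s, ∑ y ∈ S, (B x y).indicator (fun _ => w x * w y) s ∂μ ≤
      ∑ x ∈ S, w x * (48 * (n + 1) * ((1 / 2 : ℝ) ^ n) ^ t) := by
    refine Finset.sum_le_sum fun x hx => ?_
    rw [integral_finsetSum _ fun y _ => hint x y]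
    calc ∑ y ∈ S, ∫ s, (B x y).indicator (fun _ => w x * w y) s ∂μ
        = w x * ∑ y ∈ S, w y * μ.real (B x y) := by
          rw [Finset.mul_sum]
          refine Finset.sum_congr rfl fun y _ => ?_
          rw [integral_indicator_const _ (hB x y), smul_eq_mul]
          ring
      _ ≤ _ := mul_le_mul_of_nonneg_left (hrow x hx) (hw x)
  calc (2 * h)⁻¹ * ∑ x ∈ S, ∫ s, ∑ y ∈ S, (B x y).indicator (fun _ => w x * w y) s ∂μ
      ≤ (2 * h)⁻¹ * ∑ x ∈ S, w x * (48 * (n + 1) * ((1 / 2 : ℝ) ^ n) ^ t) := by gcongr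
    _ = _ := by
      rw [← Finset.sum_mul]
      field_simp
      ring

/-! ### Upper box dimension -/

theorem coverNumber_mono {X : Type*} [PseudoMetricSpace X] {A B : Set X} (h : A ⊆ B) (δ : ℝ≥0) :
    coverNumber A δ ≤ coverNumber B δ :=
  max_le_max le_rfl (externalCoveringNumber_mono_set h)

theorem coverNumber_closure_le {X : Type*} [PseudoMetricSpace X] (B : Set X) (δ : ℝ≥0) :
    coverNumber (closure B) δ ≤ coverNumber B δ := by
  refine max_le_max le_rfl (le_iInf₂ fun C hC => ?_)
  rcases C.finite_or_infinite with hf | hf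
  · refine IsCover.externalCoveringNumber_le_encard ?_
    rw [isCover_iff_subset_iUnion_closedBall] at hC ⊢
    exact closure_minimal hC (hf.isClosed_biUnion fun _ _ => isClosed_closedBall)
  · simp [hf.encard_eq]

theorem upperBoxDim_le_of_subset_closure {X : Type*} [PseudoMetricSpace X] {A B : Set X}
    (h : A ⊆ closure B) : upperBoxDim A ≤ upperBoxDim B := by
  refine limsup_le_limsup ?_
  have h1 : ∀ᶠ δ : ℝ≥0 in 𝓝[>] 0, δ < 1 := nhdsWithin_le_nhds (Iio_mem_nhds one_pos)
  filter_upwards [h1] with δ hδ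
  refine EReal.toENNReal_le_toENNReal (EReal.div_le_div_right_of_nonneg ?_ ?_)
  · rw [EReal.coe_nonneg, neg_nonneg]
    exact Real.log_nonpos δ.2 hδ.le
  · refine ENNReal.log_monotone ?_
    exact_mod_cast (coverNumber_mono h δ).trans (coverNumber_closure_le B δ)

theorem le_upperBoxDim {X : Type*} [PseudoMetricSpace X] {B : Set X} {s : ℝ≥0}
    (h : ∀ m : ℕ, ∃ n ≥ m, (2 : ℝ≥0∞) ^ (n * s : ℝ) ≤ coverNumber B ((1 / 2) ^ n)) :
    s ≤ upperBoxDim B := by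
  have hlim : Tendsto (fun n : ℕ => (1 / 2 : ℝ≥0) ^ n) atTop (𝓝[>] 0) :=
    tendsto_nhdsWithin_iff.2 ⟨NNReal.tendsto_pow_atTop_nhds_zero_of_lt_one (NNReal.half_lt_self one_ne_zero),
      Eventually.of_forall fun n => by simp⟩
  refine le_limsup_of_frequently_le (hlim.frequently ?_)
  rw [frequently_atTop]
  intro m
  -- `n ≥ 1` keeps the divisor `n * log 2` positive.
  obtain ⟨n, hn, hle⟩ := h (max m 1)
  have hn1 : 1 ≤ n := (le_max_right _ _).trans hn
  refine ⟨n, (le_max_left _ _).trans hn, ?_⟩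
  have hlog : (-Real.log ((1 / 2 : ℝ≥0) ^ n : ℝ≥0) : ℝ) = n * Real.log 2 := by
    simp [Real.log_pow]
  have hpos : 0 < n * Real.log 2 := by
    have := Real.log_pos one_lt_two
    positivity
  rw [hlog, ← EReal.toENNReal_coe (x := (s : ℝ≥0∞))]
  refine EReal.toENNReal_le_toENNReal ?_
  rw [EReal.le_div_iff_mul_le (by exact_mod_cast hpos) (EReal.coe_ne_top _)]
  refine le_trans (le_of_eq ?_) (ENNReal.log_monotone hle)
  have h2 : ENNReal.log 2 = Real.log 2 := by
    simpa using ENNReal.log_of_nnreal (two_ne_zero (α := ℝ≥0))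
  rw [ENNReal.log_rpow, h2, EReal.coe_nnreal_eq_coe_real]
  rw [← EReal.coe_mul, ← EReal.coe_mul]
  ring_nf

/-! ### Box dimension of generic projections -/

/-- The constant `c` does not depend on `n`, and the bound holds on a whole ball of directions, as
the category argument requires. -/
theorem exists_direction_le_card {A : Set (EuclideanSpace ℝ (Fin 2))}
    (hA1 : ∀ x ∈ A, ∀ y ∈ A, dist y x ≤ 1) {t : ℝ} (ht : 0 < t) (ht1 : t ≤ 1)
    (hA : μH[t] A ≠ 0) (e₀ : UnitCircle) {U : Set UnitCircle} (hU : U ∈ 𝓝 e₀) :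
    ∃ c > 0, ∀ n : ℕ, ∃ e ∈ U, ∀ e' : UnitCircle, dist e' e ≤ (1 / 2) ^ n → ∀ T : Finset ℝ,
      (∀ x ∈ A, ∃ τ ∈ T, |inner ℝ x (e' : EuclideanSpace ℝ (Fin 2)) - τ| ≤ (1 / 2) ^ n) →
      c ≤ T.card * ((n + 1) * ((1 / 2 : ℝ) ^ n) ^ t) := by
  classical
  obtain ⟨e₀, he₀⟩ := e₀
  have he₀1 : ‖e₀‖ = 1 := by simpa using he₀
  set f : EuclideanSpace ℝ (Fin 2) := !₂[-e₀ 1, e₀ 0] with hf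
  have hsq : e₀ 0 ^ 2 + e₀ 1 ^ 2 = 1 := by
    have := EuclideanSpace.real_norm_sq_eq e₀
    rw [he₀1, Fin.sum_univ_two] at this
    linarith
  have hef : ∀ z : EuclideanSpace ℝ (Fin 2), ‖z‖ ^ 2 = inner ℝ z e₀ ^ 2 + inner ℝ z f ^ 2 := by
    intro z
    rw [EuclideanSpace.real_norm_sq_eq]
    simp only [PiLp.inner_apply, Fin.sum_univ_two, hf]
    simp
    linear_combination (-(z 0) ^ 2 - (z 1) ^ 2) * hsq
  have hv : ∀ s : ℝ, ‖e₀ + s • f‖ ^ 2 = 1 + s ^ 2 := by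
    intro s
    rw [EuclideanSpace.real_norm_sq_eq, Fin.sum_univ_two]
    simp [hf]
    linear_combination (1 + s ^ 2) * hsq
  have hv0 : ∀ s : ℝ, 0 < ‖e₀ + s • f‖ := by
    intro s
    have := hv s
    refine (norm_nonneg _).lt_of_ne fun h => ?_
    rw [← h] at this
    nlinarith [sq_nonneg s]
  set E : ℝ → UnitCircle := fun s => ⟨‖e₀ + s • f‖⁻¹ • (e₀ + s • f), by
    rw [mem_sphere_zero_iff_norm, norm_smul, norm_inv, norm_norm, inv_mul_cancel₀ (hv0 s).ne']⟩
  have hEc : Continuous E := by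
    refine Continuous.subtype_mk ?_ _
    exact Continuous.smul (Continuous.inv₀ (by fun_prop) fun s => (hv0 s).ne') (by fun_prop)
  have hE0 : E 0 = ⟨e₀, he₀⟩ := Subtype.ext (by simp [E, he₀1])
  obtain ⟨r, hr, hrU⟩ := Metric.mem_nhds_iff.1 (hEc.continuousAt.preimage_mem_nhds (hE0 ▸ hU))
  set h : ℝ := min (r / 2) (1 / 4)
  have hh0 : 0 < h := by positivity
  have hh : h ≤ 1 / 4 := min_le_right _ _
  have hAb : TotallyBounded A := (Metric.isBounded_iff.2
    ⟨1, fun x hx y hy => hA1 y hy x hx⟩).isCompact_closure.totallyBounded.subset subset_closure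
  obtain ⟨c, hc, hfrost⟩ := exists_frostman_weights hAb ht hA
  refine ⟨c * h / 24, by positivity, fun n => ?_⟩
  obtain ⟨S, w, hSA, hw, hcw, hwt⟩ := hfrost n
  have hS1 : ∀ x ∈ S, ∀ y ∈ S, dist y x ≤ 1 := fun x hx y hy => hA1 x (hSA hx) y (hSA hy)
  obtain ⟨s, hs, hsum⟩ := exists_direction_sum_close_le hef hS1 hw ht1 hwt hh0 hh
  have hsh : |s| ≤ h := abs_le.2 hs
  have hv2 : ‖e₀ + s • f‖ ≤ 2 := by
    have h1 : s ^ 2 ≤ 1 := by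
      rw [← sq_abs]
      exact pow_le_one₀ (abs_nonneg s) (by linarith)
    have h2 := hv s
    nlinarith [norm_nonneg (e₀ + s • f)]
  refine ⟨E s, hrU ?_, fun e' he' T hT => ?_⟩
  · rw [mem_ball, dist_zero_right, Real.norm_eq_abs]
    have : h ≤ r / 2 := min_le_left _ _
    linarith
  have hclose := sq_sum_le_card_mul_sum_close S hw T
    (fun x => inner ℝ x (e' : EuclideanSpace ℝ (Fin 2))) (fun x hx => hT x (hSA hx))
    (fun x y => |inner ℝ (y - x) e₀ + s * inner ℝ (y - x) f| ≤ 6 * (1 / 2) ^ n) (by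
      intro x hx y hy hxy
      have h1 : |inner ℝ (y - x) ((e' : EuclideanSpace ℝ (Fin 2)) - E s)| ≤ (1 / 2) ^ n := by
        refine (abs_real_inner_le_norm _ _).trans ?_
        have h2 := hS1 x hx y hy
        rw [dist_eq_norm] at h2
        rw [Subtype.dist_eq, dist_eq_norm] at he'
        calc _ ≤ 1 * (1 / 2 : ℝ) ^ n := by gcongr
          _ = _ := one_mul _
      have h3 : inner ℝ (y - x) e₀ + s * inner ℝ (y - x) f =
          ‖e₀ + s • f‖ * inner ℝ (y - x) (E s : EuclideanSpace ℝ (Fin 2)) := by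
        simp only [E]
        rw [real_inner_smul_right, ← mul_assoc, mul_inv_cancel₀ (hv0 s).ne', one_mul,
          inner_add_right, real_inner_smul_right]
      rw [← inner_sub_left] at hxy
      rw [inner_sub_right] at h1
      rw [h3, abs_mul, abs_norm]
      -- Sharing an interval costs `2 * 2⁻ⁿ` and passing from `e'` to `E s` costs `2⁻ⁿ`; the norm
      -- `‖e₀ + s • f‖ ≤ 2` then yields the 6.
      have h4 : |inner ℝ (y - x) (E s : EuclideanSpace ℝ (Fin 2))| ≤ 3 * (1 / 2) ^ n := by
        rw [abs_le] at *
        constructor <;> linarith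
      calc _ ≤ 2 * (3 * (1 / 2 : ℝ) ^ n) := by gcongr
        _ = _ := by ring)
  set W := ∑ x ∈ S, w x
  have hW : 0 < W := hc.trans_le hcw
  have h5 : W * W ≤ T.card * (24 / h * (n + 1) * ((1 / 2 : ℝ) ^ n) ^ t) * W := by
    rw [← sq]
    refine hclose.trans ?_
    rw [mul_assoc]
    gcongr
  have h6 := hcw.trans (le_of_mul_le_mul_right h5 hW)
  calc c * h / 24 ≤ T.card * (24 / h * (n + 1) * ((1 / 2 : ℝ) ^ n) ^ t) * h / 24 := by gcongr
    _ = _ := by field_simp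

/-- The gap `s < t` absorbs the factor `n + 1` lost to the number of scales. -/
theorem tendsto_two_rpow_mul_half_rpow {s t : ℝ} (hst : s < t) :
    Tendsto (fun n : ℕ => (2 : ℝ) ^ (n * s) * ((n + 1) * ((1 / 2 : ℝ) ^ n) ^ t)) atTop (𝓝 0) := by
  have hr1 : (2 : ℝ) ^ (s - t) < 1 := Real.rpow_lt_one_of_one_lt_of_neg (by norm_num) (by linarith)
  have hr0 : (0 : ℝ) ≤ 2 ^ (s - t) := by positivity
  have h := (tendsto_self_mul_const_pow_of_lt_one hr0 hr1).add
    (tendsto_pow_atTop_nhds_zero_of_lt_one hr0 hr1)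
  rw [add_zero] at h
  refine h.congr fun n => ?_
  have h1 : ((1 / 2 : ℝ) ^ n) ^ t = 2 ^ (-(n * t)) := by
    rw [one_div, inv_pow, ← Real.rpow_natCast, ← Real.rpow_neg (by norm_num),
      ← Real.rpow_mul (by norm_num)]
    ring_nf
  have h2 : ((2 : ℝ) ^ (s - t)) ^ n = 2 ^ (n * s) * 2 ^ (-(n * t)) := by
    rw [← Real.rpow_natCast, ← Real.rpow_mul (by norm_num), ← Real.rpow_add (by norm_num)]
    ring_nf
  rw [h1, h2]
  ring

/-- For a generic direction the upper box dimension of the projection is at least any `s` below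
the Hausdorff dimension. -/
theorem eventually_residual_le_upperBoxDim {A : Set (EuclideanSpace ℝ (Fin 2))}
    (hA1 : ∀ x ∈ A, ∀ y ∈ A, dist y x ≤ 1) {t : ℝ} (ht : 0 < t) (ht1 : t ≤ 1)
    (hA : μH[t] A ≠ 0) {s : ℝ≥0} (hst : s < t) :
    ∀ᶠ e : UnitCircle in residual UnitCircle, (s : ℝ≥0∞) ≤ upperBoxDim (proj e A) := by
  set V : ℕ → Set UnitCircle := fun m =>
    {e | ∃ n ≥ m, (2 : ℝ≥0∞) ^ (n * s : ℝ) ≤ coverNumber (proj e A) ((1 / 2) ^ n)}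
  have hV : ∀ m, V m ∈ residual UnitCircle := by
    intro m
    refine mem_of_superset (residual_of_dense_open isOpen_interior ?_) (interior_subset (s := V m))
    intro e₀
    rw [mem_closure_iff_nhds]
    intro U hU
    obtain ⟨c, hc, hcard⟩ := exists_direction_le_card hA1 ht ht1 hA e₀ hU
    obtain ⟨n, hn, hnm⟩ := (((tendsto_two_rpow_mul_half_rpow hst).eventually_lt_const hc).and
      (eventually_ge_atTop m)).exists
    obtain ⟨e, heU, he⟩ := hcard n
    refine ⟨e, heU, mem_interior_iff_mem_nhds.2 (mem_of_superset
      (closedBall_mem_nhds e (by positivity : (0 : ℝ) < (1 / 2) ^ n)) fun e' he' => ?_)⟩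
    refine ⟨n, hnm, le_trans ?_ (ENat.toENNReal_mono (le_max_right _ _))⟩
    by_contra! hlt
    have htop : externalCoveringNumber ((1 / 2) ^ n) (proj e' A) ≠ ⊤ := by
      intro h
      rw [h] at hlt
      simp at hlt
    obtain ⟨N, hN⟩ := ENat.ne_top_iff_exists.1 htop
    have hlt2 : externalCoveringNumber ((1 / 2) ^ n) (proj e' A) < (N + 1 : ℕ) := by
      rw [← hN]
      exact_mod_cast Nat.lt_succ_self N
    obtain ⟨C, hC, hCN⟩ := by simpa only [externalCoveringNumber, iInf_lt_iff] using hlt2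
    have hCf : C.Finite := finite_of_encard_le_coe hCN.le
    lift C to Finset ℝ using hCf
    rw [encard_coe_eq_coe_finsetCard] at hCN
    have hCN' : C.card ≤ N := Nat.lt_succ_iff.1 (by exact_mod_cast hCN)
    have h1 := he e' he' C (fun x hx => by
      rw [isCover_iff_subset_iUnion_closedBall] at hC
      obtain ⟨τ, hτ, hxτ⟩ := mem_iUnion₂.1 (hC ⟨x, hx, rfl⟩)
      exact ⟨τ, hτ, by simpa [Real.dist_eq] using hxτ⟩)
    rw [← hN] at hlt
    have h2 : (N : ℝ) < 2 ^ (n * s : ℝ) := by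
      have h3 : ((2 : ℝ≥0∞) ^ (n * s : ℝ)) = ENNReal.ofReal (2 ^ (n * s : ℝ)) := by
        rw [← ENNReal.ofReal_rpow_of_pos (by norm_num)]
        simp
      rw [h3, ENat.toENNReal_coe, ENNReal.lt_ofReal_iff_toReal_lt (by simp)] at hlt
      simpa using hlt
    have h4 : (C.card : ℝ) ≤ 2 ^ (n * s : ℝ) := (Nat.cast_le.2 hCN').trans h2.le
    refine absurd (h1.trans (mul_le_mul_of_nonneg_right h4 (by positivity))) (not_le.2 hn)
  filter_upwards [eventually_countable_forall.2 hV] with e he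
  exact le_upperBoxDim he

/-! ### From box dimension to packing dimension -/

/-- A continuous image of a Polish space contains, away from countably many small pieces, a
closed set all of whose open portions have large image. -/
theorem exists_isClosed_forall_lt_dimH_image {Z X : Type*} [TopologicalSpace Z]
    [SecondCountableTopology Z] [EMetricSpace X] (f : Z → X) {d : ℝ≥0∞} (hd : d < dimH (range f)) :
    ∃ P : Set Z, IsClosed P ∧ P.Nonempty ∧
      ∀ O : Set Z, IsOpen O → (P ∩ O).Nonempty → d < dimH (f '' (P ∩ O)) := by
  set 𝓑 := TopologicalSpace.countableBasis Z
  set 𝓢 : Set (Set Z) := {O ∈ 𝓑 | dimH (f '' O) ≤ d}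
  have h𝓢 : 𝓢.Countable := (TopologicalSpace.countable_countableBasis Z).mono (sep_subset _ _)
  have hdim : dimH (f '' ⋃₀ 𝓢) ≤ d := by
    rw [sUnion_eq_biUnion, image_iUnion₂, dimH_bUnion h𝓢]
    exact iSup₂_le fun O hO => hO.2
  have hopen : IsOpen (⋃₀ 𝓢) :=
    isOpen_sUnion fun O hO => TopologicalSpace.isOpen_of_mem_countableBasis hO.1
  refine ⟨(⋃₀ 𝓢)ᶜ, hopen.isClosed_compl, ?_, ?_⟩
  · by_contra! h
    rw [compl_empty_iff] at h
    rw [h, image_univ] at hdim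
    exact hdim.not_gt hd
  · rintro O hO ⟨z, hz, hzO⟩
    by_contra! hle
    obtain ⟨O', hO', hzO', hsub⟩ :=
      (TopologicalSpace.isBasis_countableBasis Z).exists_subset_of_mem_open hzO hO
    refine hz ⟨O', ⟨hO', ?_⟩, hzO'⟩
    have : f '' O' ⊆ f '' ((⋃₀ 𝓢)ᶜ ∩ O) ∪ f '' ⋃₀ 𝓢 := by
      rw [← image_union]
      refine image_mono fun y hy => ?_
      by_cases h : y ∈ ⋃₀ 𝓢
      · exact Or.inr h
      · exact Or.inl ⟨h, hsub hy⟩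
    refine (dimH_mono this).trans ?_
    rw [dimH_union]
    exact max_le hle hdim

/-- Frostman weights control only scales up to 1, hence the restriction to diameter at most 1. -/
theorem exists_subset_dist_le_lt_dimH {X : Type*} [MetricSpace X] [SecondCountableTopology X]
    {A : Set X} {d : ℝ≥0∞} (hd : d < dimH A) :
    ∃ A' ⊆ A, (∀ x ∈ A', ∀ y ∈ A', dist y x ≤ 1) ∧ d < dimH A' := by
  obtain ⟨x, _, hx⟩ := exists_mem_nhdsWithin_lt_dimH_of_lt_dimH hd
  refine ⟨A ∩ ball x (1 / 2), inter_subset_left, fun y hy z hz => ?_,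
    hx _ (inter_mem_nhdsWithin _ (ball_mem_nhds x (by norm_num)))⟩
  have h1 := mem_ball.1 hy.2
  have h2 := mem_ball.1 hz.2
  have := dist_triangle_right z y x
  linarith

theorem eventually_residual_le_packingDim {K : Set (EuclideanSpace ℝ (Fin 2))}
    (hK : AnalyticSet K) (hdim : dimH K ≤ 1) {s : ℝ≥0} (hs : s < dimH K) :
    ∀ᶠ e : UnitCircle in residual UnitCircle, (s : ℝ≥0∞) ≤ packingDim (proj e K) := by
  rw [AnalyticSet] at hK
  rcases hK with rfl | ⟨f, hf, rfl⟩
  · simp at hs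
  obtain ⟨t, hst, htK⟩ := ENNReal.lt_iff_exists_nnreal_btwn.1 hs
  have hst' : (s : ℝ) < t := by exact_mod_cast hst
  have ht0 : (0 : ℝ) < t := lt_of_le_of_lt s.2 hst'
  have ht1 : (t : ℝ) ≤ 1 := by exact_mod_cast (htK.trans_le hdim).le
  obtain ⟨P, hPc, ⟨p, hp⟩, hP⟩ := exists_isClosed_forall_lt_dimH_image f htK
  have hpiece : ∀ O ∈ {O ∈ TopologicalSpace.countableBasis (ℕ → ℕ) | (P ∩ O).Nonempty},
      ∀ᶠ e : UnitCircle in residual UnitCircle,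
        (s : ℝ≥0∞) ≤ upperBoxDim (proj e (f '' (P ∩ O))) := by
    intro O hO
    obtain ⟨A, hA, hA1, hAd⟩ := exists_subset_dist_le_lt_dimH
      (hP O (TopologicalSpace.isOpen_of_mem_countableBasis hO.1) hO.2)
    have hAm : μH[(t : ℝ)] A ≠ 0 := by simp [hausdorffMeasure_of_lt_dimH hAd]
    filter_upwards [eventually_residual_le_upperBoxDim hA1 ht0 ht1 hAm hst'] with e he
    exact he.trans (upperBoxDim_le_of_subset_closure ((image_mono hA).trans subset_closure))
  -- The generic `e` is fixed before the cover `F`, so it must serve all basic portions at once.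
  filter_upwards [(eventually_countable_ball ((TopologicalSpace.countable_countableBasis
    (ℕ → ℕ)).mono (sep_subset _ _))).2 hpiece] with e he
  refine le_iInf fun F => le_iInf fun _ => le_iInf fun hF => ?_
  have : PolishSpace P := hPc.polishSpace
  have : Nonempty P := ⟨⟨p, hp⟩⟩
  set g : P → ℝ := fun z => inner ℝ (f z) (e : EuclideanSpace ℝ (Fin 2))
  have hg : Continuous g := by fun_prop
  obtain ⟨j, z, hz⟩ := nonempty_interior_of_iUnion_of_closed
    (f := fun j => g ⁻¹' closure (F j)) (fun j => isClosed_closure.preimage hg) (by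
      refine eq_univ_of_forall fun z => ?_
      obtain ⟨j, hj⟩ := mem_iUnion.1 (hF ⟨f z, ⟨z, rfl⟩, rfl⟩)
      exact mem_iUnion.2 ⟨j, subset_closure hj⟩)
  obtain ⟨G, hG, hGi⟩ := isOpen_induced_iff.1
    (isOpen_interior (s := g ⁻¹' closure (F j)))
  have hzG : (z : ℕ → ℕ) ∈ G := by
    rw [← hGi] at hz
    exact hz
  obtain ⟨O, hO, hzO, hOG⟩ :=
    (TopologicalSpace.isBasis_countableBasis (ℕ → ℕ)).exists_subset_of_mem_open hzG hG
  refine (he O ⟨hO, z, z.2, hzO⟩).trans (le_trans (upperBoxDim_le_of_subset_closure ?_)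
    (le_iSup (fun j => upperBoxDim (F j)) j))
  rintro _ ⟨_, ⟨y, ⟨hyP, hyO⟩, rfl⟩, rfl⟩
  have : (⟨y, hyP⟩ : P) ∈ interior (g ⁻¹' closure (F j)) := by
    rw [← hGi]
    exact hOG hyO
  exact (interior_subset this : (⟨y, hyP⟩ : P) ∈ g ⁻¹' closure (F j))

theorem mainTheorem9 (K : Set (EuclideanSpace ℝ (Fin 2)))
    (hK : MeasureTheory.AnalyticSet K) (hdim : dimH K ≤ 1) :
    IsMeagre {e : UnitCircle | packingDim (proj e K) < dimH K} := by
  -- Rational levels leave only countably many residual sets to intersect.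
  have h : ∀ q : ℚ, ∀ᶠ e : UnitCircle in residual UnitCircle,
      ((Real.toNNReal q : ℝ≥0) : ℝ≥0∞) < dimH K →
        ((Real.toNNReal q : ℝ≥0) : ℝ≥0∞) ≤ packingDim (proj e K) := by
    intro q
    by_cases hq : ((Real.toNNReal q : ℝ≥0) : ℝ≥0∞) < dimH K
    · filter_upwards [eventually_residual_le_packingDim hK hdim hq] with e he _ using he
    · exact Eventually.of_forall fun e h => absurd h hq
  rw [IsMeagre]
  filter_upwards [eventually_countable_forall.2 h] with e he hlt
  obtain ⟨q, _, hq1, hq2⟩ := ENNReal.lt_iff_exists_rat_btwn.1 hlt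
  exact (he q hq2).not_gt hq1
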